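/- Let $0<q<1$, $\alpha>-1$, $t\ge 0$, write $(a;q)_\infty=\prod_{j=0}^{\infty}(1-aq^j)$, and consider on $[0,\infty)$ the weight $$w(x)=\frac{x^{\alpha}}{(-(1-q)x;q)_\infty\,(-(1-q)t/x;q)_\infty}.$$ Let $\{P_n\}_{n\ge 0}$ be the monic polynomials ($\deg P_n=n$) orthogonal with respect to $w$, with $\int_0^\infty P_n(x)P_m(x)w(x)\,dx=h_n\delta_{nm}$. Let $\alpha_n$ ($n\ge 0$) and $\beta_n$ ($n\ge 1$) be the coefficients of their three-term recurrence $$xP_n(x)=P_{n+1}(x)+\alpha_nP_n(x)+\beta_nP_{n-1}(x)\quad(n\ge0),\qquad \beta_0P_{-1}=0 .$$ Put $$R_n=\frac1{h_n}\int_0^\infty P_n(y)P_n(y/q)\frac{w(y)}{y}\,dy\ \ (n\ge0),\qquad r_n=\frac1{h_{n-1}}\int_0^\infty P_n(y)P_{n-1}(y/q)\frac{w(y)}{y}\,dy\ \ (n\ge1),$$ and $S_{n-1}=\sum_{j=0}^{n-1}R_j$ (so $S_{-1}=0$). All polynomials are integrable against $w$, all $h_n$ are positive, the recurrence coefficients exist,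 and, if $t>0$ or $\alpha>0$, all polynomials are integrable against $w(y)/y$, so that $R_n$ and $r_n$ are well defined (if $t=0$, the terms below that carry the factor $t$ are understood to be $0$). Moreover, for every $n\ge 0$, $$q^{2n+\alpha}\alpha_n=\frac{1-q^n}{1-q}+\frac{1-q^{n+\alpha+1}}{q(1-q)}+q^n\,\frac tq\,\bigl(R_n+(1-q)S_{n-1}\bigr),$$ and for every $n\ge1$, $$\beta_nq^{2n-1}=\frac1{q^{2\alpha}q^{2n}}\,\frac{1-q^n}{1-q}\,\frac{1-q^{n+\alpha}}{1-q}+\frac{1-q^n}{q^\alpha}\,\frac tq+\frac{q^n}{q^\alpha}\,\frac tq\,r_n+\frac1{q^{2\alpha}q^n}\,\frac tq\,S_{n-1}.$$ -/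

import Mathlib

open Polynomial MeasureTheory

namespace QLaguerre

/-- The infinite `q`-shifted factorial `(a;q)_∞ = ∏_{j ≥ 0} (1 - a q^j)`
(the product converges absolutely for `|q| < 1`). -/
noncomputable def qPochInf (a q : ℝ) : ℝ := ∏' j : ℕ, (1 - a * q ^ j)

/-- The deformed `q`-Laguerre weight
`w(x) = x^α / ((-(1-q)x;q)_∞ (-(1-q)t/x;q)_∞)`, used for `x > 0` only. -/
noncomputable def weight (q α t x : ℝ) : ℝ :=
  x ^ α / (qPochInf (-((1 - q) * x)) q * qPochInf (-((1 - q) * (t / x))) q)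

/-- `P` is the sequence of monic polynomials (`deg P n = n`) which is orthogonal on the half-line
`[0, ∞)` with respect to `w(x) dx`. (The endpoint `0` is a null set.) -/
structure IsMonicOrthogonal (w : ℝ → ℝ) (P : ℕ → ℝ[X]) : Prop where
  monic : ∀ n, (P n).Monic
  natDegree_eq : ∀ n, (P n).natDegree = n
  orthogonal : ∀ m n, m ≠ n →
    ∫ x in Set.Ioi (0 : ℝ), (P m).eval x * (P n).eval x * w x = 0

/-- The squared norm `h_n = ∫_0^∞ P_n(x)^2 w(x) dx`. -/
noncomputable def sqNorm (w : ℝ → ℝ) (P : ℕ → ℝ[X]) (n : ℕ) : ℝ :=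
  ∫ x in Set.Ioi (0 : ℝ), (P n).eval x * (P n).eval x * w x

/-- `a n` and `b n` are the coefficients of the recurrence
`x P_n = P_{n+1} + a_n P_n + b_n P_{n-1}` (`n ≥ 0`), where the term `b_0 P_{-1}` is `0`
(the value `b 0` plays no role). -/
structure IsRecurrence (P : ℕ → ℝ[X]) (a b : ℕ → ℝ) : Prop where
  zero : X * P 0 = P 1 + C (a 0) * P 0
  succ : ∀ n, X * P (n + 1) = P (n + 2) + C (a (n + 1)) * P (n + 1) + C (b (n + 1)) * P n

/-- `R_n = (1 / h_n) ∫_0^∞ P_n(y) P_n(y/q) w(y) / y dy`. -/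
noncomputable def auxR (q : ℝ) (w : ℝ → ℝ) (P : ℕ → ℝ[X]) (n : ℕ) : ℝ :=
  1 / sqNorm w P n *
    ∫ y in Set.Ioi (0 : ℝ), (P n).eval y * (P n).eval (y / q) * (w y / y)

/-- `r_n = (1 / h_{n-1}) ∫_0^∞ P_n(y) P_{n-1}(y/q) w(y) / y dy`, used for `n ≥ 1` only. -/
noncomputable def auxr (q : ℝ) (w : ℝ → ℝ) (P : ℕ → ℝ[X]) (n : ℕ) : ℝ :=
  1 / sqNorm w P (n - 1) *
    ∫ y in Set.Ioi (0 : ℝ), (P n).eval y * (P (n - 1)).eval (y / q) * (w y / y)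

/-- `sumR n` is `S_{n-1} = ∑_{j=0}^{n-1} R_j`. -/
noncomputable def sumR (q : ℝ) (w : ℝ → ℝ) (P : ℕ → ℝ[X]) (n : ℕ) : ℝ :=
  ∑ j ∈ Finset.range n, auxR q w P j

end QLaguerre

/-!
The weight satisfies the `q`-Pearson equation
`w(x) (1 + (1-q) t/x) = q^α w(x/q) (1 + (1-q) x/q)`, which follows from
`(a;q)_∞ = (1 - a) (aq;q)_∞`. Put `L p = ∫ p w` and `T p = t ∫ p w / y`. Substituting `x = q y`
turns the Pearson equation into
`L (p(·/q)) + (1-q) T (p(·/q)) = q^(α+1) L (p (1 + (1-q) x))` for all polynomials `p`.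
Both formulas are instances of this one identity (`integral_pearson`).

* With `p(x) = P_n(x) P_n(qx)` (`pearson_diag`), expanding both sides by orthogonality gives a
  relation between `α_n`, `t R_n` and `σ_n = ∑_{j<n} α_j`, because `-σ_n` is the subleading
  coefficient of `P_n`. As `α_n = σ_{n+1} - σ_n`, this is a first order recursion for `σ_n`, solved
  in closed form by `sum_range_of_diag`; inserting the solution gives the formula for `α_n`.
* With `p(x) = P_{n+1}(x) P_n(qx)` (`pearson_offdiag`), the right-hand side is a multiple of
  `h_{n+1} = β_{n+1} h_n`. On the left, `L` yields `σ_{n+1}`, and `T (P_n(y) P_{n+1}(y/q))` is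
  `t h_n r_{n+1}` up to an explicit multiple of `t h_n`, because `T (x p) = t L p` reduces `T (P_m f)`
  to the constant term of `f` and one value of `L`. The closed form of `σ_{n+1}` finishes.

Convergence rests on `(-c;q)_∞ ≥ K c^k` for every `k` (`exists_mul_pow_le_qPochInf_neg`): the weight
decays faster than any power at infinity and, if `t > 0`, at the origin. The functional `T` carries
the factor `t`, so that it is a well-defined linear functional also when `t = 0`.
-/

namespace QLaguerre

/-! ### Orthogonal polynomials of a linear functional -/

section Functional

variable {L : ℝ[X] →ₗ[ℝ] ℝ} {P : ℕ → ℝ[X]}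

theorem coeff_self_eq_one (hm : ∀ n, (P n).Monic) (hd : ∀ n, (P n).natDegree = n) (n : ℕ) :
    (P n).coeff n = 1 := by
  have := (hm n).coeff_natDegree
  rwa [hd n] at this

theorem apply_mul_eq_zero_of_degree_lt (hm : ∀ n, (P n).Monic) (hd : ∀ n, (P n).natDegree = n)
    (ho : ∀ m n, m ≠ n → L (P m * P n) = 0) (n : ℕ) {f : ℝ[X]} (hf : f.degree < n) :
    L (P n * f) = 0 := by
  suffices H : ∀ k ≤ n, ∀ f : ℝ[X], f.degree < k → L (P n * f) = 0 from H n le_rfl f hf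
  intro k
  induction k with
  | zero =>
    intro _ f hf
    have : f = 0 := by simpa using hf
    simp [this]
  | succ k ih =>
    intro hk f hf
    have hPk : (P k).degree = k := by
      rw [degree_eq_natDegree (hm k).ne_zero, hd k]
    have hlow : (f - C (f.coeff k) * P k).degree < k := by
      rw [degree_lt_iff_coeff_zero]
      intro m hkm
      rcases hkm.eq_or_lt with rfl | hlt
      · simp [coeff_self_eq_one hm hd]
      · have h1 : f.coeff m = 0 := (degree_lt_iff_coeff_zero f (k + 1)).1 hf m hlt
        have h2 : (P k).coeff m = 0 := coeff_eq_zero_of_natDegree_lt (by rw [hd k]; exact hlt)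
        simp [h1, h2]
    have hsplit : P n * f = P n * (f - C (f.coeff k) * P k) + f.coeff k • (P n * P k) := by
      rw [smul_eq_C_mul]; ring
    rw [hsplit, map_add, map_smul, ih (by omega) _ hlow, ho n k (by omega)]
    simp

/-- Pairing `P n` with a polynomial of degree at most `n` picks out its coefficient of `X ^ n`. -/
theorem apply_mul_of_natDegree_le (hm : ∀ n, (P n).Monic) (hd : ∀ n, (P n).natDegree = n)
    (ho : ∀ m n, m ≠ n → L (P m * P n) = 0) (n : ℕ) {f : ℝ[X]} (hf : f.natDegree ≤ n) :
    L (P n * f) = f.coeff n * L (P n * P n) := by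
  have hlow : (f - C (f.coeff n) * P n).degree < n := by
    rw [degree_lt_iff_coeff_zero]
    intro m hkm
    rcases hkm.eq_or_lt with rfl | hlt
    · simp [coeff_self_eq_one hm hd]
    · have h1 : f.coeff m = 0 := coeff_eq_zero_of_natDegree_lt (by omega)
      have h2 : (P n).coeff m = 0 := coeff_eq_zero_of_natDegree_lt (by rw [hd n]; exact hlt)
      simp [h1, h2]
  have hsplit : P n * f = P n * (f - C (f.coeff n) * P n) + f.coeff n • (P n * P n) := by
    rw [smul_eq_C_mul]; ring
  rw [hsplit, map_add, map_smul, apply_mul_eq_zero_of_degree_lt hm hd ho n hlow]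
  simp

/-- Pairing `P n` with a polynomial of degree at most `n + 1` involves its two top coefficients and
the subleading coefficient of `P (n + 1)`. -/
theorem apply_mul_of_natDegree_le_succ (hm : ∀ n, (P n).Monic) (hd : ∀ n, (P n).natDegree = n)
    (ho : ∀ m n, m ≠ n → L (P m * P n) = 0) (n : ℕ) {f : ℝ[X]} (hf : f.natDegree ≤ n + 1) :
    L (P n * f) = (f.coeff n - f.coeff (n + 1) * (P (n + 1)).coeff n) * L (P n * P n) := by
  have hlow : (f - C (f.coeff (n + 1)) * P (n + 1)).natDegree ≤ n := by
    rw [natDegree_le_iff_coeff_eq_zero]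
    intro m hkm
    rcases (Nat.succ_le_of_lt hkm).eq_or_lt with rfl | hlt
    · simp [coeff_self_eq_one hm hd (n + 1)]
    · have h1 : f.coeff m = 0 := coeff_eq_zero_of_natDegree_lt (by omega)
      have h2 : (P (n + 1)).coeff m = 0 :=
        coeff_eq_zero_of_natDegree_lt (by rw [hd (n + 1)]; exact hlt)
      simp [h1, h2]
  have hsplit : P n * f = P n * (f - C (f.coeff (n + 1)) * P (n + 1))
      + f.coeff (n + 1) • (P n * P (n + 1)) := by
    rw [smul_eq_C_mul]; ring
  rw [hsplit, map_add, map_smul, apply_mul_of_natDegree_le hm hd ho n hlow,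
    ho n (n + 1) (by omega)]
  simp

theorem apply_X_mul_mul_succ (hm : ∀ n, (P n).Monic) (hd : ∀ n, (P n).natDegree = n)
    (ho : ∀ m n, m ≠ n → L (P m * P n) = 0) (n : ℕ) :
    L (P n * (X * P (n + 1))) = L (P (n + 1) * P (n + 1)) := by
  have : P n * (X * P (n + 1)) = P (n + 1) * (X * P n) := by ring
  rw [this, apply_mul_of_natDegree_le hm hd ho (n + 1)
    (by rw [natDegree_X_mul (hm n).ne_zero, hd n]), coeff_X_mul, coeff_self_eq_one hm hd, one_mul]

/-- `a n` is read off from the top coefficients and `b n` is a ratio of squared norms; the difference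
of both sides is then orthogonal to every `P k` up to its own degree, hence zero. -/
theorem exists_isRecurrence (hm : ∀ n, (P n).Monic) (hd : ∀ n, (P n).natDegree = n)
    (ho : ∀ m n, m ≠ n → L (P m * P n) = 0) (hne : ∀ n, L (P n * P n) ≠ 0) :
    ∃ a b : ℕ → ℝ, IsRecurrence P a b := by
  have hself := coeff_self_eq_one hm hd
  have hbig : ∀ {n m : ℕ}, n < m → (P n).coeff m = 0 := fun {n m} h =>
    coeff_eq_zero_of_natDegree_lt (by rw [hd n]; exact h)
  refine ⟨fun n => (X * P n).coeff n - (P (n + 1)).coeff n,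
    fun n => L (P n * P n) / L (P (n - 1) * P (n - 1)), ?_, ?_⟩
  · ext m
    rcases m with _ | _ | m
    · simp [hself 0]
    · simp [hself 0, hself 1, hbig (show 0 < 1 by omega), coeff_X_mul]
    · simp [coeff_X_mul, hbig (show 0 < m + 1 by omega), hbig (show 0 < m + 1 + 1 by omega),
        hbig (show 1 < m + 1 + 1 by omega)]
  · intro n
    simp only [Nat.add_sub_cancel]
    set a := (X * P (n + 1)).coeff (n + 1) - (P (n + 1 + 1)).coeff (n + 1) with ha
    set b := L (P (n + 1) * P (n + 1)) / L (P n * P n) with hb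
    set D := X * P (n + 1) - (P (n + 2) + C a * P (n + 1) + C b * P n) with hD
    rw [← sub_eq_zero, ← hD]
    have hDdeg : D.natDegree ≤ n := by
      rw [natDegree_le_iff_coeff_eq_zero]
      intro m hnm
      rcases (Nat.succ_le_of_lt hnm).eq_or_lt with rfl | hlt
      · simp only [hD, coeff_sub, coeff_add, coeff_C_mul, hself (n + 1), ha,
          hbig (Nat.lt_succ_self n), Nat.succ_eq_add_one]
        ring
      · obtain ⟨m, rfl⟩ : ∃ k, m = k + 1 := ⟨m - 1, by omega⟩
        rcases (show n + 1 ≤ m by omega).eq_or_lt with rfl | hlt'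
        · simp [hD, hself (n + 1), hself (n + 2), hbig (show n + 1 < n + 1 + 1 by omega),
            hbig (show n < n + 1 + 1 by omega), coeff_X_mul]
        · simp [hD, coeff_X_mul, hbig hlt', hbig (show n + 1 < m + 1 by omega),
            hbig (show n + 2 < m + 1 by omega), hbig (show n < m + 1 by omega)]
    have hpair : ∀ k ≤ n, L (P k * D) = 0 := by
      intro k hk
      have hsplit : P k * D = P k * (X * P (n + 1)) - (P k * P (n + 2) + a • (P k * P (n + 1))
          + b • (P k * P n)) := by
        simp only [hD, smul_eq_C_mul]; ring
      rw [hsplit, map_sub, map_add, map_add, map_smul, map_smul, ho k (n + 2) (by omega),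
        ho k (n + 1) (by omega)]
      rcases hk.eq_or_lt with rfl | hlt
      · rw [apply_X_mul_mul_succ hm hd ho, hb]
        have := hne k
        simp only [smul_eq_mul]
        field_simp
        ring
      · have : P k * (X * P (n + 1)) = P (n + 1) * (X * P k) := by ring
        rw [ho k n (by omega), this, apply_mul_eq_zero_of_degree_lt hm hd ho]
        · simp
        · rw [degree_lt_iff_coeff_zero]
          intro m hm'
          obtain ⟨m, rfl⟩ : ∃ k, m = k + 1 := ⟨m - 1, by omega⟩
          rw [coeff_X_mul, hbig (by omega)]
    have h0 := hpair D.natDegree hDdeg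
    rw [apply_mul_of_natDegree_le hm hd ho _ le_rfl, mul_eq_zero] at h0
    exact leadingCoeff_eq_zero.1 (h0.resolve_right (hne _))

theorem IsRecurrence.coeff_succ {a b : ℕ → ℝ} (h : IsRecurrence P a b)
    (hm : ∀ n, (P n).Monic) (hd : ∀ n, (P n).natDegree = n) (n : ℕ) :
    (P (n + 1)).coeff n = -∑ j ∈ Finset.range (n + 1), a j := by
  induction n with
  | zero =>
    have := congrArg (fun p => p.coeff 0) h.zero
    simp only [mul_coeff_zero, coeff_X_zero, zero_mul, coeff_add, coeff_C_zero,
      coeff_self_eq_one hm hd 0] at this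
    simp; linarith
  | succ n ih =>
    have := congrArg (fun p => p.coeff (n + 1)) (h.succ n)
    simp only [coeff_X_mul, coeff_add, coeff_C_mul, coeff_self_eq_one hm hd (n + 1),
      coeff_eq_zero_of_natDegree_lt (show (P n).natDegree < n + 1 by rw [hd n]; omega)] at this
    rw [Finset.sum_range_succ]
    linarith

/-- `β_{n+1} h_n = h_{n+1}`. -/
theorem IsRecurrence.mul_apply_self {a b : ℕ → ℝ} (h : IsRecurrence P a b)
    (hm : ∀ n, (P n).Monic) (hd : ∀ n, (P n).natDegree = n)
    (ho : ∀ m n, m ≠ n → L (P m * P n) = 0) (n : ℕ) :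
    b (n + 1) * L (P n * P n) = L (P (n + 1) * P (n + 1)) := by
  rw [← apply_X_mul_mul_succ hm hd ho n, h.succ n]
  have : P n * (P (n + 2) + C (a (n + 1)) * P (n + 1) + C (b (n + 1)) * P n) =
      P n * P (n + 2) + a (n + 1) • (P n * P (n + 1)) + b (n + 1) • (P n * P n) := by
    simp only [smul_eq_C_mul]; ring
  rw [this, map_add, map_add, map_smul, map_smul, ho n (n + 2) (by omega),
    ho n (n + 1) (by omega)]
  simp

/-! ### The `q`-Pearson relation on products of orthogonal polynomials -/

variable {T : ℝ[X] →ₗ[ℝ] ℝ} {t q c : ℝ}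

/-- `dilate r p` is the polynomial `p(r x)`. -/
noncomputable def dilate (r : ℝ) (p : ℝ[X]) : ℝ[X] := p.comp (C r * X)

theorem coeff_dilate (r : ℝ) (p : ℝ[X]) (n : ℕ) : (dilate r p).coeff n = p.coeff n * r ^ n :=
  comp_C_mul_X_coeff

theorem natDegree_dilate_le (r : ℝ) (p : ℝ[X]) : (dilate r p).natDegree ≤ p.natDegree := by
  rw [natDegree_le_iff_coeff_eq_zero]
  intro m h
  rw [coeff_dilate, coeff_eq_zero_of_natDegree_lt h, zero_mul]

theorem dilate_mul (r : ℝ) (f g : ℝ[X]) : dilate r (f * g) = dilate r f * dilate r g :=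
  mul_comp _ _ _

theorem eval_dilate (r x : ℝ) (p : ℝ[X]) : (dilate r p).eval x = p.eval (r * x) := by
  simp [dilate]

theorem dilate_inv_dilate {r : ℝ} (hr : r ≠ 0) (p : ℝ[X]) : dilate r⁻¹ (dilate r p) = p := by
  ext n
  rw [coeff_dilate, coeff_dilate, mul_assoc, ← mul_pow, mul_inv_cancel₀ hr, one_pow, mul_one]

/-- Splitting `f = x g + f(0)` reduces `T` to `L`. -/
theorem apply_mul_eq_coeff_zero_add (hT : ∀ p, T (X * p) = t * L p) (p f : ℝ[X]) :
    T (p * f) = f.coeff 0 * T p + t * L (p * f.divX) := by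
  have : p * f = X * (p * f.divX) + f.coeff 0 • p := by
    conv_lhs => rw [← divX_mul_X_add f]
    rw [smul_eq_C_mul]; ring
  rw [this, map_add, map_smul, hT, smul_eq_mul, add_comm]

/-- The `q`-Pearson relation tested on `P n (x) P n (q x)`. The first sum on the right is minus the
subleading coefficient of `P (n + 1)`, the second one that of `P n`. -/
theorem pearson_diag (hm : ∀ n, (P n).Monic) (hd : ∀ n, (P n).natDegree = n)
    (ho : ∀ m n, m ≠ n → L (P m * P n) = 0) (hne : ∀ n, L (P n * P n) ≠ 0) (hq : q ≠ 0)
    (hpear : ∀ p, L (dilate q⁻¹ p) + (1 - q) * T (dilate q⁻¹ p) =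
      c * L (p * (1 + (1 - q) • X)))
    {a b : ℕ → ℝ} (h : IsRecurrence P a b) (n : ℕ) :
    (q ^ n)⁻¹ + (1 - q) * (T (P n * dilate q⁻¹ (P n)) / L (P n * P n)) =
      c * (q ^ n + (1 - q) * (q ^ n * ∑ j ∈ Finset.range (n + 1), a j
        - q ^ n / q * ∑ j ∈ Finset.range n, a j)) := by
  have h1 := hpear (dilate q (P n) * P n)
  have hdeg : (dilate q (P n) * (1 + (1 - q) • (X : ℝ[X]))).natDegree ≤ n + 1 := by
    refine natDegree_mul_le.trans (add_le_add ((natDegree_dilate_le _ _).trans (hd n).le) ?_)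
    refine (natDegree_add_le _ _).trans (max_le (by simp) ?_)
    exact (natDegree_smul_le _ _).trans natDegree_X_le
  rw [dilate_mul, dilate_inv_dilate hq, mul_comm (dilate q (P n)), mul_assoc,
    apply_mul_of_natDegree_le hm hd ho n ((natDegree_dilate_le _ _).trans (hd n).le),
    apply_mul_of_natDegree_le_succ hm hd ho n hdeg, h.coeff_succ hm hd, coeff_dilate,
    coeff_self_eq_one hm hd] at h1
  have e1 : (dilate q (P n) * (1 + (1 - q) • X)).coeff (n + 1) = (1 - q) * q ^ n := by
    rw [mul_add, mul_one, mul_smul_comm, coeff_add, coeff_smul, coeff_mul_X, coeff_dilate,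
      coeff_dilate, coeff_self_eq_one hm hd,
      coeff_eq_zero_of_natDegree_lt (show (P n).natDegree < n + 1 by rw [hd n]; omega)]
    simp
  have e2 : (dilate q (P n) * (1 + (1 - q) • X)).coeff n =
      q ^ n - (1 - q) * (q ^ n / q * ∑ j ∈ Finset.range n, a j) := by
    rw [mul_add, mul_one, mul_smul_comm, coeff_add, coeff_smul, coeff_dilate,
      coeff_self_eq_one hm hd]
    rcases n with _ | n
    · simp
    · rw [coeff_mul_X, coeff_dilate, h.coeff_succ hm hd, pow_succ, mul_div_assoc, div_self hq]
      simp; ring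
  rw [e1, e2, inv_pow] at h1
  have := hne n
  field_simp at h1 ⊢
  linear_combination h1

/-- The `q`-Pearson relation tested on `P (n + 1) (x) P n (q x)`. Substituting `q⁻¹ x` moves the
dilation onto `P (n + 1)`, and `t * ((q ^ (n + 1))⁻¹ - 1)` is the cost of moving it back. -/
theorem pearson_offdiag (hm : ∀ n, (P n).Monic) (hd : ∀ n, (P n).natDegree = n)
    (ho : ∀ m n, m ≠ n → L (P m * P n) = 0) (hne : ∀ n, L (P n * P n) ≠ 0) (hq : q ≠ 0)
    (hq1 : q ≠ 1) (hT : ∀ p, T (X * p) = t * L p)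
    (hpear : ∀ p, L (dilate q⁻¹ p) + (1 - q) * T (dilate q⁻¹ p) =
      c * L (p * (1 + (1 - q) • X)))
    {a b : ℕ → ℝ} (h : IsRecurrence P a b) (n : ℕ) :
    (q ^ (n + 1))⁻¹ * ∑ j ∈ Finset.range (n + 1), a j
      + (T (P (n + 1) * dilate q⁻¹ (P n)) / L (P n * P n) + t * ((q ^ (n + 1))⁻¹ - 1)) =
      c * (q ^ n * b (n + 1)) := by
  have hself := coeff_self_eq_one hm hd
  -- `T (P (n + 1) * f)` only sees `f(0)` when `deg f ≤ n`, so a dilation of `f` does not matter.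
  have t0 : ∀ f : ℝ[X], f.natDegree ≤ n → T (P (n + 1) * f) = f.coeff 0 * T (P (n + 1)) := by
    intro f hf
    rw [apply_mul_eq_coeff_zero_add hT, apply_mul_eq_zero_of_degree_lt hm hd ho (n + 1), mul_zero,
      add_zero]
    rw [degree_lt_iff_coeff_zero]
    intro m hnm
    rw [coeff_divX, coeff_eq_zero_of_natDegree_lt (by omega)]
  have t1 : T (P (n + 1) * dilate q⁻¹ (P n)) = T (P n * P (n + 1)) := by
    rw [mul_comm (P n), t0 _ ((natDegree_dilate_le _ _).trans (hd n).le), t0 _ (hd n).le,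
      coeff_dilate]
    simp
  have hdiv : ∀ f : ℝ[X], f.natDegree ≤ n + 1 → f.divX.natDegree ≤ n := by
    intro f hf
    rw [natDegree_divX_eq_natDegree_tsub_one]; omega
  have hdil : (dilate q⁻¹ (P (n + 1))).natDegree ≤ n + 1 :=
    (natDegree_dilate_le _ _).trans (hd (n + 1)).le
  have t2 : T (P n * dilate q⁻¹ (P (n + 1))) =
      T (P (n + 1) * dilate q⁻¹ (P n)) + t * ((q ^ (n + 1))⁻¹ - 1) * L (P n * P n) := by
    rw [t1, apply_mul_eq_coeff_zero_add hT, apply_mul_eq_coeff_zero_add hT _ (P (n + 1)),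
      apply_mul_of_natDegree_le hm hd ho n (hdiv _ hdil),
      apply_mul_of_natDegree_le hm hd ho n (hdiv _ (hd (n + 1)).le), coeff_divX, coeff_divX,
      coeff_dilate, coeff_dilate, hself, inv_pow]
    simp; ring
  have h1 := hpear (dilate q (P n) * P (n + 1))
  have e1 : dilate q (P n) * P (n + 1) * (1 + (1 - q) • X) =
      P (n + 1) * (dilate q (P n) * (1 + (1 - q) • X)) := by ring
  have hdeg : (dilate q (P n) * (1 + (1 - q) • (X : ℝ[X]))).natDegree ≤ n + 1 := by
    refine natDegree_mul_le.trans (add_le_add ((natDegree_dilate_le _ _).trans (hd n).le) ?_)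
    refine (natDegree_add_le _ _).trans (max_le (by simp) ?_)
    exact (natDegree_smul_le _ _).trans natDegree_X_le
  have e2 : (dilate q (P n) * (1 + (1 - q) • X)).coeff (n + 1) = (1 - q) * q ^ n := by
    rw [mul_add, mul_one, mul_smul_comm, coeff_add, coeff_smul, coeff_mul_X, coeff_dilate,
      coeff_dilate, hself,
      coeff_eq_zero_of_natDegree_lt (show (P n).natDegree < n + 1 by rw [hd n]; omega)]
    simp
  rw [e1, dilate_mul, dilate_inv_dilate hq, t2, apply_mul_of_natDegree_le_succ hm hd ho n hdil,
    apply_mul_of_natDegree_le hm hd ho (n + 1) hdeg, e2, coeff_dilate, coeff_dilate, hself,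
    h.coeff_succ hm hd, ← h.mul_apply_self hm hd ho, inv_pow, inv_pow] at h1
  have hn := hne n
  have hq' : 1 - q ≠ 0 := sub_ne_zero.2 hq1.symm
  have hqn : q ^ n ≠ 0 := pow_ne_zero _ hq
  rw [pow_succ] at h1 ⊢
  field_simp at h1 ⊢
  refine mul_left_cancel₀ hq' ?_
  linear_combination h1

end Functional

/-! ### Growth of the infinite product and convergence of the integrals -/

section Analysis
open Filter Set

variable {q : ℝ}

theorem multipliable_qPochInf (hq0 : 0 ≤ q) (hq1 : q < 1) (a : ℝ) :
    Multipliable fun j : ℕ => 1 - a * q ^ j := by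
  simp only [sub_eq_add_neg]
  exact Real.multipliable_one_add_of_summable
    (((summable_geometric_of_lt_one hq0 hq1).mul_left a).neg)

theorem qPochInf_eq_mul (hq0 : 0 ≤ q) (hq1 : q < 1) (a : ℝ) :
    qPochInf a q = (1 - a) * qPochInf (a * q) q := by
  have h : ∀ j : ℕ, 1 - a * q ^ (j + 1) = 1 - a * q * q ^ j := fun j => by ring
  rw [qPochInf, tprod_eq_zero_mul' (by simpa only [h] using multipliable_qPochInf hq0 hq1 (a * q))]
  simp only [h, pow_zero, mul_one, qPochInf]

theorem one_le_qPochInf_neg (hq0 : 0 ≤ q) {c : ℝ} (hc : 0 ≤ c) : 1 ≤ qPochInf (-c) q := by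
  by_cases h : Multipliable fun j : ℕ => 1 - -c * q ^ j
  · refine ge_of_tendsto' h.hasProd.tendsto_prod_nat fun n => ?_
    refine Finset.one_le_prod fun j _ => ?_
    have := mul_nonneg hc (pow_nonneg hq0 j)
    linarith
  -- A product that is not multipliable has the value `1` by convention.
  · rw [qPochInf, tprod_eq_one_of_not_multipliable h]

/-- `(-c;q)_∞` grows faster than any power of `c`. -/
theorem exists_mul_pow_le_qPochInf_neg (hq0 : 0 < q) (hq1 : q < 1) (k : ℕ) :
    ∃ K > 0, ∀ c : ℝ, 0 ≤ c → K * c ^ k ≤ qPochInf (-c) q := by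
  induction k with
  | zero => exact ⟨1, one_pos, fun c hc => by simpa using one_le_qPochInf_neg hq0.le hc⟩
  | succ k ih =>
    obtain ⟨K, hK, h⟩ := ih
    refine ⟨K * q ^ k, by positivity, fun c hc => ?_⟩
    have h1 := h (c * q) (by positivity)
    rw [qPochInf_eq_mul hq0.le hq1, neg_mul]
    have h0 : 0 ≤ K * (c * q) ^ k := by positivity
    calc K * q ^ k * c ^ (k + 1) = c * (K * (c * q) ^ k) := by ring
      _ ≤ (1 - -c) * qPochInf (-(c * q)) q :=
        mul_le_mul (by linarith) h1 h0 (by linarith)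

theorem measurable_qPochInf (hq0 : 0 ≤ q) (hq1 : q < 1) : Measurable fun a => qPochInf a q := by
  refine measurable_of_tendsto_metrizable (f := fun n a => ∏ j ∈ Finset.range n, (1 - a * q ^ j))
    (fun n => by fun_prop) ?_
  rw [tendsto_pi_nhds]
  exact fun a => (multipliable_qPochInf hq0 hq1 a).hasProd.tendsto_prod_nat

theorem measurable_weight (hq0 : 0 ≤ q) (hq1 : q < 1) (s t : ℝ) : Measurable (weight q s t) := by
  have := measurable_qPochInf hq0 hq1
  unfold weight
  refine (measurable_id.pow_const s).div ((this.comp (f := fun x : ℝ => -((1 - q) * x))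
    (by fun_prop)).mul (this.comp (f := fun x : ℝ => -((1 - q) * (t / x))) (by fun_prop)))

theorem weight_pos (hq0 : 0 ≤ q) (hq1 : q < 1) (s : ℝ) {t x : ℝ} (ht : 0 ≤ t) (hx : 0 < x) :
    0 < weight q s t x := by
  have h1 := one_le_qPochInf_neg hq0 (c := (1 - q) * x)
    (mul_nonneg (by linarith) hx.le)
  have h2 := one_le_qPochInf_neg hq0 (c := (1 - q) * (t / x))
    (mul_nonneg (by linarith) (by positivity))
  unfold weight
  have := Real.rpow_pos_of_pos hx s
  positivity

theorem weight_le (s : ℝ) {t x A B : ℝ} (hx : 0 < x) (hA : 0 < A)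
    (hB : 0 < B) (h1 : A ≤ qPochInf (-((1 - q) * x)) q)
    (h2 : B ≤ qPochInf (-((1 - q) * (t / x))) q) : weight q s t x ≤ x ^ s / (A * B) :=
  div_le_div_of_nonneg_left (Real.rpow_nonneg hx.le s) (by positivity)
    (mul_le_mul h1 h2 hB.le (hA.le.trans h1))

theorem rpow_mul_weight (s u t : ℝ) {x : ℝ} (hx : 0 < x) :
    x ^ u * weight q s t x = weight q (u + s) t x := by
  rw [weight, weight, Real.rpow_add hx, mul_div_assoc]

theorem integrableOn_weight_Ioc (hq0 : 0 < q) (hq1 : q < 1) {s t : ℝ} (ht : 0 ≤ t)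
    (h : 0 < t ∨ -1 < s) : IntegrableOn (weight q s t) (Ioc 0 1) := by
  have key : ∃ C e : ℝ, -1 < e ∧ ∀ x ∈ Ioc (0 : ℝ) 1, weight q s t x ≤ C * x ^ e := by
    have hA : ∀ x : ℝ, 0 < x → 1 ≤ qPochInf (-((1 - q) * x)) q := fun x hx =>
      one_le_qPochInf_neg hq0.le (mul_nonneg (by linarith) hx.le)
    rcases h with h | h
    · -- The factor in `t / x` beats any power of `1 / x`.
      obtain ⟨k, hk⟩ := exists_nat_gt (-1 - s)
      obtain ⟨K, hK, hF⟩ := exists_mul_pow_le_qPochInf_neg hq0 hq1 k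
      have hc : 0 < (1 - q) * t := mul_pos (by linarith) h
      refine ⟨1 / (K * ((1 - q) * t) ^ k), s + k, by linarith, fun x hx => ?_⟩
      have hx0 : 0 < x := hx.1
      have h2 := hF ((1 - q) * (t / x)) (mul_nonneg (by linarith) (by positivity))
      have hpos : 0 < K * ((1 - q) * (t / x)) ^ k :=
        mul_pos hK (pow_pos (mul_pos (by linarith) (by positivity)) k)
      refine (weight_le s hx0 one_pos hpos (hA x hx0) h2).trans_eq ?_
      rw [Real.rpow_add_natCast hx0.ne', ← mul_div_assoc, div_pow]
      field_simp
    · refine ⟨1, s, h, fun x hx => ?_⟩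
      have h2 := one_le_qPochInf_neg hq0.le (c := (1 - q) * (t / x))
        (mul_nonneg (by linarith) (div_nonneg ht hx.1.le))
      refine (weight_le s hx.1 one_pos one_pos (hA x hx.1) h2).trans_eq ?_
      simp
  obtain ⟨C, e, he, hC⟩ := key
  have hint : IntegrableOn (fun x : ℝ => C * x ^ e) (Ioc 0 1) :=
    ((intervalIntegrable_iff_integrableOn_Ioc_of_le zero_le_one).1
      (intervalIntegral.intervalIntegrable_rpow' he)).const_mul C
  refine Integrable.mono' hint (measurable_weight hq0.le hq1 s t).aestronglyMeasurable ?_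
  filter_upwards [ae_restrict_mem measurableSet_Ioc] with x hx
  rw [Real.norm_of_nonneg (weight_pos hq0.le hq1 s ht hx.1).le]
  exact hC x hx

theorem integrableOn_weight_Ioi_one (hq0 : 0 < q) (hq1 : q < 1) (s : ℝ) {t : ℝ} (ht : 0 ≤ t) :
    IntegrableOn (weight q s t) (Ioi 1) := by
  obtain ⟨k, hk⟩ := exists_nat_gt (s + 1)
  obtain ⟨K, hK, hF⟩ := exists_mul_pow_le_qPochInf_neg hq0 hq1 k
  have hint : IntegrableOn (fun x : ℝ => 1 / (K * (1 - q) ^ k) * x ^ (s - k)) (Ioi 1) :=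
    (integrableOn_Ioi_rpow_of_lt (by linarith) one_pos).const_mul _
  refine Integrable.mono' hint (measurable_weight hq0.le hq1 s t).aestronglyMeasurable ?_
  filter_upwards [ae_restrict_mem measurableSet_Ioi] with x hx
  have hx0 : 0 < x := one_pos.trans hx
  rw [Real.norm_of_nonneg (weight_pos hq0.le hq1 s ht hx0).le]
  have hq : 0 < 1 - q := by linarith
  have h1 := hF ((1 - q) * x) (by positivity)
  have h2 := one_le_qPochInf_neg hq0.le (c := (1 - q) * (t / x)) (by positivity)
  refine (weight_le s hx0 (by positivity) one_pos h1 h2).trans_eq ?_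
  rw [Real.rpow_sub_natCast hx0.ne', mul_pow]
  field_simp

theorem integrableOn_weight (hq0 : 0 < q) (hq1 : q < 1) {s t : ℝ} (ht : 0 ≤ t)
    (h : 0 < t ∨ -1 < s) : IntegrableOn (weight q s t) (Ioi 0) := by
  rw [← Ioc_union_Ioi_eq_Ioi zero_le_one]
  exact (integrableOn_weight_Ioc hq0 hq1 ht h).union (integrableOn_weight_Ioi_one hq0 hq1 s ht)

theorem integrableOn_eval_mul_weight (hq0 : 0 < q) (hq1 : q < 1) {s t : ℝ} (ht : 0 ≤ t)
    (h : 0 < t ∨ -1 < s) (p : ℝ[X]) :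
    IntegrableOn (fun x => p.eval x * weight q s t x) (Ioi 0) := by
  induction p using Polynomial.induction_on' with
  | add p r hp hr =>
    simp only [eval_add, add_mul]
    exact hp.add hr
  | monomial n c =>
    have hn : IntegrableOn (fun x => c * weight q (n + s) t x) (Ioi 0) :=
      (integrableOn_weight hq0 hq1 ht (h.imp_right fun h' => by
        have : (0 : ℝ) ≤ n := n.cast_nonneg
        linarith)).const_mul c
    refine hn.congr_fun (fun x hx => ?_) measurableSet_Ioi
    simp only [eval_monomial]
    rw [← rpow_mul_weight s n t hx, Real.rpow_natCast, mul_assoc]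

theorem integrableOn_eval_mul_weight_div (hq0 : 0 < q) (hq1 : q < 1) {s t : ℝ} (ht : 0 ≤ t)
    (h : 0 < t ∨ 0 < s) (p : ℝ[X]) :
    IntegrableOn (fun y => p.eval y * (weight q s t y / y)) (Ioi 0) := by
  refine (integrableOn_eval_mul_weight hq0 hq1 (s := -1 + s) ht
    (h.imp_right fun h' => by linarith) p).congr_fun (fun x hx => ?_) measurableSet_Ioi
  simp only
  rw [← rpow_mul_weight s (-1) t hx, Real.rpow_neg_one, div_eq_inv_mul]

/-! ### The `q`-Pearson equation of the weight -/

theorem weight_pearson (hq0 : 0 < q) (hq1 : q < 1) (α : ℝ) {t x : ℝ} (ht : 0 ≤ t) (hx : 0 < x) :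
    weight q α t x * (1 + (1 - q) * (t / x)) =
      q ^ α * (weight q α t (q⁻¹ * x) * (1 + (1 - q) * (q⁻¹ * x))) := by
  have hq : 0 < 1 - q := by linarith
  have hy : 0 < q⁻¹ * x := by positivity
  have f1 := qPochInf_eq_mul hq0.le hq1 (-((1 - q) * (q⁻¹ * x)))
  have f2 := qPochInf_eq_mul hq0.le hq1 (-((1 - q) * (t / x)))
  have e1 : -((1 - q) * (q⁻¹ * x)) * q = -((1 - q) * x) := by field_simp
  have e2 : -((1 - q) * (t / x)) * q = -((1 - q) * (t / (q⁻¹ * x))) := by field_simp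
  rw [e1] at f1
  rw [e2] at f2
  have p1 := one_le_qPochInf_neg hq0.le (c := (1 - q) * x) (by positivity)
  have p2 := one_le_qPochInf_neg hq0.le (c := (1 - q) * (t / (q⁻¹ * x))) (by positivity)
  have hxa : x ^ α = q ^ α * (q⁻¹ * x) ^ α := by
    rw [← Real.mul_rpow hq0.le hy.le, mul_inv_cancel_left₀ hq0.ne']
  have d1 : 0 < 1 - -((1 - q) * (q⁻¹ * x)) := by
    have : 0 < (1 - q) * (q⁻¹ * x) := by positivity
    linarith
  have d2 : 0 < 1 - -((1 - q) * (t / x)) := by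
    have : 0 ≤ (1 - q) * (t / x) := by positivity
    linarith
  unfold weight
  rw [f1, f2, hxa, show 1 + (1 - q) * (t / x) = 1 - -((1 - q) * (t / x)) by ring,
    show 1 + (1 - q) * (q⁻¹ * x) = 1 - -((1 - q) * (q⁻¹ * x)) by ring]
  generalize qPochInf (-((1 - q) * x)) q = A at *
  generalize qPochInf (-((1 - q) * (t / (q⁻¹ * x)))) q = B at *
  generalize 1 - -((1 - q) * (q⁻¹ * x)) = D at *
  generalize 1 - -((1 - q) * (t / x)) = E at *
  field_simp

/-- The linear functional `p ↦ ∫ p v` over the half-line, for `v` with finite moments. -/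
noncomputable def functional (v : ℝ → ℝ)
    (hv : ∀ p : ℝ[X], IntegrableOn (fun x => p.eval x * v x) (Ioi 0)) : ℝ[X] →ₗ[ℝ] ℝ where
  toFun p := ∫ x in Ioi (0 : ℝ), p.eval x * v x
  map_add' p r := by
    simp only [eval_add, add_mul]
    exact integral_add (hv p) (hv r)
  map_smul' c p := by
    simp only [eval_smul, smul_eq_mul, mul_assoc, RingHom.id_apply]
    exact integral_const_mul _ _

/-- The factor `t` makes this hold for `t = 0` as well, where `w(y) / y` need not be integrable. -/
theorem integrableOn_eval_mul_const_mul_weight_div (hq0 : 0 < q) (hq1 : q < 1) (α : ℝ) {t : ℝ}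
    (ht : 0 ≤ t) (p : ℝ[X]) :
    IntegrableOn (fun y => p.eval y * (t * (weight q α t y / y))) (Ioi 0) := by
  rcases ht.eq_or_lt with rfl | h
  · simp
  · simp only [mul_left_comm _ t]
    exact (integrableOn_eval_mul_weight_div hq0 hq1 (s := α) ht (Or.inl h) p).const_mul t

theorem integral_pearson (hq0 : 0 < q) (hq1 : q < 1) {α t : ℝ} (hα : -1 < α) (ht : 0 ≤ t)
    (p : ℝ[X]) :
    (∫ x in Ioi (0 : ℝ), (dilate q⁻¹ p).eval x * weight q α t x) + (1 - q) *
      (∫ x in Ioi (0 : ℝ), (dilate q⁻¹ p).eval x * (t * (weight q α t x / x))) =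
    q ^ (α + 1) * ∫ x in Ioi (0 : ℝ), (p * (1 + (1 - q) • X)).eval x * weight q α t x := by
  rw [← integral_const_mul, ← integral_add
    (integrableOn_eval_mul_weight hq0 hq1 ht (Or.inr hα) _)
    ((integrableOn_eval_mul_const_mul_weight_div hq0 hq1 α ht _).const_mul _)]
  have hscale := integral_comp_mul_left_Ioi
    (fun x => (p * (1 + (1 - q) • X)).eval x * weight q α t x) 0 (inv_pos.2 hq0)
  rw [mul_zero, inv_inv, smul_eq_mul] at hscale
  rw [Real.rpow_add_one hq0.ne', mul_assoc, ← hscale, ← integral_const_mul]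
  refine setIntegral_congr_fun measurableSet_Ioi fun x hx => ?_
  have := weight_pearson hq0 hq1 α ht hx
  simp only [eval_dilate, eval_mul, eval_add, eval_one, eval_smul, eval_X, smul_eq_mul]
  linear_combination p.eval (q⁻¹ * x) * this

theorem integral_sq_mul_weight_pos (hq0 : 0 < q) (hq1 : q < 1) {α t : ℝ} (hα : -1 < α)
    (ht : 0 ≤ t) {p : ℝ[X]} (hp : p ≠ 0) :
    0 < ∫ x in Ioi (0 : ℝ), p.eval x * p.eval x * weight q α t x := by
  rw [setIntegral_pos_iff_support_of_nonneg_ae]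
  · have hsub : Ioi (0 : ℝ) \ {x | p.IsRoot x} ⊆
        Function.support (fun x => p.eval x * p.eval x * weight q α t x) ∩ Ioi 0 := by
      rintro x ⟨hx, hr⟩
      exact ⟨mul_ne_zero (mul_ne_zero hr hr) (weight_pos hq0.le hq1 α ht hx).ne', hx⟩
    refine lt_of_lt_of_le ?_ (measure_mono hsub)
    rw [measure_sdiff_null ((finite_setOfPred_isRoot hp).measure_zero volume)]
    simp
  · filter_upwards [ae_restrict_mem measurableSet_Ioi] with x hx
    exact mul_nonneg (mul_self_nonneg _) (weight_pos hq0.le hq1 α ht hx).le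
  · simpa only [eval_mul] using integrableOn_eval_mul_weight hq0 hq1 ht (Or.inr hα) (p * p)

end Analysis

/-! ### Solving the recursion for the partial sums -/

section Solve

variable {q v : ℝ} {a τ : ℕ → ℝ}

/-- The closed form of the partial sums of the `a j`. Here `v` stands for `q ^ α` and `τ n` for
`t * R_n`. -/
theorem sum_range_of_diag (hq : q ≠ 0) (hq1 : q ≠ 1)
    (h : ∀ n, (q ^ n)⁻¹ + (1 - q) * τ n = v * q * (q ^ n + (1 - q) *
      (q ^ n * ∑ j ∈ Finset.range (n + 1), a j - q ^ n / q * ∑ j ∈ Finset.range n, a j))) (n : ℕ) :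
    v * (q ^ n) ^ 2 * ∑ j ∈ Finset.range n, a j =
      q * ((1 - q ^ n) * (1 - q ^ n * v) / (1 - q) ^ 2)
        + q ^ n * ∑ j ∈ Finset.range n, τ j := by
  have hq' : 1 - q ≠ 0 := sub_ne_zero.2 hq1.symm
  induction n with
  | zero => simp
  | succ n ih =>
    have hn := h n
    have hqn : q ^ n ≠ 0 := pow_ne_zero _ hq
    rw [Finset.sum_range_succ _ n, pow_succ q n]
    rw [Finset.sum_range_succ _ n] at hn
    rw [Finset.sum_range_succ _ n]
    generalize ∑ j ∈ Finset.range n, a j = A at *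
    generalize ∑ j ∈ Finset.range n, τ j = S at *
    generalize q ^ n = u at *
    field_simp at hn ih ⊢
    linear_combination -(1 - q) * hn + ih

end Solve

end QLaguerre

theorem lemma3 (q α t : ℝ) (hq0 : 0 < q) (hq1 : q < 1) (hα : -1 < α) (ht : 0 ≤ t)
    (P : ℕ → Polynomial ℝ)
    (hP : QLaguerre.IsMonicOrthogonal (QLaguerre.weight q α t) P) :
    -- all the integrals converge and the norms are positive
    (∀ p : Polynomial ℝ, MeasureTheory.IntegrableOn
      (fun x => p.eval x * QLaguerre.weight q α t x) (Set.Ioi 0)) ∧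
    (0 < t ∨ 0 < α → ∀ p : Polynomial ℝ, MeasureTheory.IntegrableOn
      (fun y => p.eval y * (QLaguerre.weight q α t y / y)) (Set.Ioi 0)) ∧
    (∀ n, 0 < QLaguerre.sqNorm (QLaguerre.weight q α t) P n) ∧
    -- the recurrence coefficients exist, and they are given by the two formulas
    (∃ a b : ℕ → ℝ, QLaguerre.IsRecurrence P a b) ∧
    ∀ a b : ℕ → ℝ, QLaguerre.IsRecurrence P a b →
      (∀ n : ℕ,
        q ^ (2 * (n : ℝ) + α) * a n =
          (1 - q ^ n) / (1 - q) + (1 - q ^ ((n : ℝ) + α + 1)) / (q * (1 - q)) +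
            q ^ n * (t / q) * (QLaguerre.auxR q (QLaguerre.weight q α t) P n +
              (1 - q) * QLaguerre.sumR q (QLaguerre.weight q α t) P n)) ∧
      (∀ n : ℕ, 1 ≤ n →
        b n * q ^ (2 * (n : ℤ) - 1) =
          1 / (q ^ (2 * α) * q ^ (2 * n)) * ((1 - q ^ n) / (1 - q)) *
              ((1 - q ^ ((n : ℝ) + α)) / (1 - q)) +
            (1 - q ^ n) / q ^ α * (t / q) +
            q ^ n / q ^ α * (t / q) * QLaguerre.auxr q (QLaguerre.weight q α t) P n +
            1 / (q ^ (2 * α) * q ^ n) * (t / q) *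
              QLaguerre.sumR q (QLaguerre.weight q α t) P n) := by
  obtain ⟨hm, hd, ho⟩ := hP
  have hI := QLaguerre.integrableOn_eval_mul_weight hq0 hq1 ht (Or.inr hα)
  have hJ := QLaguerre.integrableOn_eval_mul_const_mul_weight_div hq0 hq1 α ht
  set L := QLaguerre.functional (QLaguerre.weight q α t) hI
  set T := QLaguerre.functional (fun y => t * (QLaguerre.weight q α t y / y)) hJ
  have hLapp : ∀ p r, L (p * r) =
      ∫ x in Set.Ioi (0 : ℝ), p.eval x * r.eval x * QLaguerre.weight q α t x := fun p r => by
    simp only [← eval_mul]; rfl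
  have hnorm : ∀ n, QLaguerre.sqNorm (QLaguerre.weight q α t) P n = L (P n * P n) :=
    fun n => (hLapp _ _).symm
  have horth : ∀ m n, m ≠ n → L (P m * P n) = 0 := fun m n h => by rw [hLapp, ho m n h]
  have hpos : ∀ n, 0 < QLaguerre.sqNorm (QLaguerre.weight q α t) P n := fun n =>
    QLaguerre.integral_sq_mul_weight_pos hq0 hq1 hα ht (hm n).ne_zero
  have hne : ∀ n, L (P n * P n) ≠ 0 := fun n => hnorm n ▸ (hpos n).ne'
  have hTX : ∀ p, T (X * p) = t * L p := fun p => by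
    refine Eq.trans ?_ (integral_const_mul t _)
    refine setIntegral_congr_fun measurableSet_Ioi fun x hx => ?_
    have hx0 : x ≠ 0 := (Set.mem_Ioi.1 hx).ne'
    simp only [eval_mul, eval_X]
    field_simp
  have hpear : ∀ p, L (QLaguerre.dilate q⁻¹ p) + (1 - q) * T (QLaguerre.dilate q⁻¹ p) =
      q ^ α * q * L (p * (1 + (1 - q) • X)) := fun p => by
    rw [← Real.rpow_add_one hq0.ne']
    exact QLaguerre.integral_pearson hq0 hq1 hα ht p
  have hTapp : ∀ m n, T (P m * QLaguerre.dilate q⁻¹ (P n)) = t * ∫ y in Set.Ioi (0 : ℝ),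
      (P m).eval y * (P n).eval (y / q) * (QLaguerre.weight q α t y / y) := fun m n => by
    rw [← integral_const_mul]
    refine setIntegral_congr_fun measurableSet_Ioi fun x _ => ?_
    simp only [eval_mul, QLaguerre.eval_dilate, div_eq_inv_mul x q]
    ring
  have hR : ∀ n, T (P n * QLaguerre.dilate q⁻¹ (P n)) / L (P n * P n) =
      t * QLaguerre.auxR q (QLaguerre.weight q α t) P n := fun n => by
    rw [hTapp, QLaguerre.auxR, hnorm]; ring
  have hr : ∀ n, T (P (n + 1) * QLaguerre.dilate q⁻¹ (P n)) / L (P n * P n) =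
      t * QLaguerre.auxr q (QLaguerre.weight q α t) P (n + 1) := fun n => by
    rw [hTapp, QLaguerre.auxr, Nat.add_sub_cancel, hnorm]; ring
  have hq' : 1 - q ≠ 0 := sub_ne_zero.2 hq1.ne'
  have hv : q ^ α ≠ 0 := (Real.rpow_pos_of_pos hq0 α).ne'
  refine ⟨hI, fun h => QLaguerre.integrableOn_eval_mul_weight_div hq0 hq1 ht h, hpos,
    QLaguerre.exists_isRecurrence hm hd horth hne, fun a b hab => ?_⟩
  have hdiag : ∀ n, _ := QLaguerre.pearson_diag hm hd horth hne hq0.ne' hpear hab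
  have hoff : ∀ n, _ :=
    QLaguerre.pearson_offdiag hm hd horth hne hq0.ne' hq1.ne hTX hpear hab
  simp only [hR] at hdiag
  simp only [hr] at hoff
  have hsum := QLaguerre.sum_range_of_diag hq0.ne' hq1.ne hdiag
  simp only [← Finset.mul_sum] at hsum
  refine ⟨fun n => ?_, fun n hn => ?_⟩
  · have h1 := hdiag n
    have h2 := hsum n
    rw [Finset.sum_range_succ] at h1
    rw [Real.rpow_add_one hq0.ne', Real.rpow_add hq0, Real.rpow_add hq0, two_mul,
      Real.rpow_add hq0, Real.rpow_natCast, QLaguerre.sumR]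
    have hu : q ^ n ≠ 0 := pow_ne_zero _ hq0.ne'
    generalize QLaguerre.auxR q (QLaguerre.weight q α t) P n = R at *
    generalize ∑ j ∈ Finset.range n, QLaguerre.auxR q (QLaguerre.weight q α t) P j = S at *
    generalize ∑ j ∈ Finset.range n, a j = A at *
    generalize q ^ α = v at *
    generalize q ^ n = u at *
    field_simp at h1 h2 ⊢
    linear_combination -h1 + h2
  · obtain ⟨n, rfl⟩ : ∃ k, n = k + 1 := ⟨n - 1, by omega⟩
    have h1 := hoff n
    have h2 := hsum (n + 1)
    have hz : q ^ (2 * ((n + 1 : ℕ) : ℤ) - 1) = q ^ (n + 1) * q ^ n := by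
      rw [← pow_add, ← zpow_natCast]
      congr 1
      push_cast; ring
    -- Everything is expressed through `u = q ^ (n + 1)` and `v = q ^ α`.
    have hp : q ^ n = q ^ (n + 1) / q := by rw [pow_succ, mul_div_cancel_right₀ _ hq0.ne']
    have hu : q ^ (n + 1) ≠ 0 := pow_ne_zero _ hq0.ne'
    rw [hz, hp, mul_comm 2 (n + 1), pow_mul, two_mul α, Real.rpow_add hq0, Real.rpow_add hq0,
      Real.rpow_natCast, QLaguerre.sumR]
    rw [hp] at h1
    generalize QLaguerre.auxr q (QLaguerre.weight q α t) P (n + 1) = r at *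
    generalize ∑ j ∈ Finset.range (n + 1), QLaguerre.auxR q (QLaguerre.weight q α t) P j = S at *
    generalize ∑ j ∈ Finset.range (n + 1), a j = A at *
    generalize q ^ α = v at *
    generalize q ^ (n + 1) = u at *
    field_simp at h1 h2 ⊢
    linear_combination h2 - u ^ 2 * v * (1 - q) ^ 2 * h1
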